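/- For finite sets $A,B$ of positive integers put $AB=\{ab: a\in A,\ b\in B\}$, $A/B=\{a/b: a\in A,\ b\in B\}$ and let $E(A,B)=|\{(a_1,a_2,b_1,b_2)\in A^2\times B^2: a_1b_1=a_2b_2\}|$ be their multiplicative energy. Let $Q\to\infty$ (through an arbitrary family of real numbers), let $A=A_Q$, $B=B_Q$ be sets of integers in $[1,Q]$, and let $o(1)$ denote real quantities tending to $0$ along the family. If $$E(A,B)=|A||B|\exp\Bigl\{(2\log 2+o(1))\frac{\log Q}{\log\log Q}\Bigr\},\qquad Q\to\infty,$$ then $$|A/B|=|A||B|\exp\Bigl\{o(1)\,\frac{\log Q}{\log\log Q}\Bigr\},\qquad Q\to\infty.$$ In particular, the same conclusion holds if $$|AB|=|A||B|\exp\Bigl\{(-2\log 2+o(1))\frac{\log Q}{\log\log Q}\Bigr\},\qquad Q\to\infty.$$ -/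

import Mathlib

open Filter Topology
open scoped Pointwise

/-- The quotient set `A / B = {a / b : a ∈ A, b ∈ B, b ≠ 0}`, a finite set of rational numbers. -/
def quotientSet (A B : Finset ℕ) : Finset ℚ :=
  Finset.image₂ (fun a b : ℕ => (a : ℚ) / (b : ℚ)) A (B.filter (fun b => b ≠ 0))

/-- `X = Y * exp {(c + o(1)) log Q / log log Q}` along the filter `l`, where `o(1)` is a
real function tending to `0` along `l`. -/
def EqMulExp {ι : Type*} (l : Filter ι) (Q X Y : ι → ℝ) (c : ℝ) : Prop :=
  ∃ e : ι → ℝ, Tendsto e l (𝓝 0) ∧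
    ∀ᶠ i in l, X i =
      Y i * Real.exp ((c + e i) * (Real.log (Q i) / Real.log (Real.log (Q i))))

/-! Write L = log Q / log log Q and τ for the divisor function. The energy is at most the sum of
τ(ab) over A × B, and by Wigert each τ(ab) ≤ τ(a)τ(b) ≤ exp((2 log 2 + o(1))L). Near-maximal energy
therefore makes τ(ab) nearly maximal on a set G of at least |A||B|exp(-o(L)) pairs. Since
τ(ab)³τ(gcd(a,b)) ≤ τ(a)³τ(b)³, G can be taken so that its pairs satisfy τ(gcd(a,b)) ≤ exp(o(L)).

Cauchy–Schwarz for (a,b) ↦ a/b on G reduces the claim to counting ab' = a'b with (a,b), (a',b') in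
G. Such a solution is determined by a, b' and the reduced form u/v of a/a'. Here u divides gcd(a,b)
and v divides gcd(a',b'), so u ∣ a and v ∣ b' themselves have few divisors. Rankin's trick leaves
only exp(o(L)) choices for each (`card_filter_mul_eq_mul_le`, `card_filter_card_divisors_le`).

The product set case follows from |A|²|B|² ≤ |AB| E(A,B). -/

/-! ### Divisor function inequalities, prime by prime. -/

theorem card_divisors_eq_prod {n : ℕ} (hn : n ≠ 0) {S : Finset ℕ} (hS : n.primeFactors ⊆ S) :
    n.divisors.card = ∏ p ∈ S, (n.factorization p + 1) := by
  rw [Nat.card_divisors hn]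
  refine Finset.prod_subset hS fun p _ hp => ?_
  have : n.factorization p = 0 := by
    rwa [← Finsupp.notMem_support_iff, Nat.support_factorization]
  simp [this]

theorem card_divisors_mul_le {a b : ℕ} (ha : a ≠ 0) (hb : b ≠ 0) :
    (a * b).divisors.card ≤ a.divisors.card * b.divisors.card := by
  have hab := Nat.primeFactors_mul ha hb
  rw [card_divisors_eq_prod (mul_ne_zero ha hb) subset_rfl,
    card_divisors_eq_prod ha (S := (a * b).primeFactors) (hab ▸ Finset.subset_union_left),
    card_divisors_eq_prod hb (S := (a * b).primeFactors) (hab ▸ Finset.subset_union_right),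
    ← Finset.prod_mul_distrib]
  refine Finset.prod_le_prod' fun p _ => ?_
  rw [Nat.factorization_mul ha hb, Finsupp.add_apply]
  nlinarith [Nat.zero_le (a.factorization p * b.factorization p)]

/-- Local factor of the gcd inequality. The exponent 3 cannot be lowered to 2: at m = n = 1 that
would read 18 ≤ 16. -/
theorem succ_add_pow_three_mul_le {m n : ℕ} (h : m ≤ n) :
    (m + n + 1) ^ 3 * (m + 1) ≤ (m + 1) ^ 3 * (n + 1) ^ 3 := by
  obtain ⟨k, rfl⟩ := Nat.exists_eq_add_of_le h
  rcases Nat.eq_zero_or_pos m with rfl | hm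
  · simp
  -- In terms of j = m - 1 and k = n - m the difference of the two sides has nonnegative
  -- coefficients.
  · obtain ⟨j, rfl⟩ : ∃ j, m = j + 1 := ⟨m - 1, by omega⟩
    zify
    rw [← sub_nonneg]
    ring_nf
    positivity

/-- Pairs with a large common divisor have a product with few divisors. -/
theorem card_divisors_mul_pow_three_mul_gcd_le {a b : ℕ} (ha : a ≠ 0) (hb : b ≠ 0) :
    (a * b).divisors.card ^ 3 * (a.gcd b).divisors.card ≤
      a.divisors.card ^ 3 * b.divisors.card ^ 3 := by
  have hab := Nat.primeFactors_mul ha hb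
  have hg : a.gcd b ≠ 0 := (Nat.gcd_pos_of_pos_left _ (Nat.pos_of_ne_zero ha)).ne'
  rw [card_divisors_eq_prod (mul_ne_zero ha hb) subset_rfl,
    card_divisors_eq_prod ha (S := (a * b).primeFactors) (hab ▸ Finset.subset_union_left),
    card_divisors_eq_prod hb (S := (a * b).primeFactors) (hab ▸ Finset.subset_union_right),
    card_divisors_eq_prod hg (S := (a * b).primeFactors)
      (Nat.primeFactors_mono ((Nat.gcd_dvd_left a b).trans (dvd_mul_right a b))
        (mul_ne_zero ha hb)),
    ← Finset.prod_pow, ← Finset.prod_pow, ← Finset.prod_pow,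
    ← Finset.prod_mul_distrib, ← Finset.prod_mul_distrib]
  refine Finset.prod_le_prod' fun p _ => ?_
  rw [Nat.factorization_mul ha hb, Nat.factorization_gcd ha hb, Finsupp.add_apply,
    Finsupp.inf_apply]
  rcases le_total (a.factorization p) (b.factorization p) with h | h
  · rw [inf_eq_left.2 h]; exact succ_add_pow_three_mul_le h
  · rw [inf_eq_right.2 h, add_comm (a.factorization p), mul_comm ((a.factorization p + 1) ^ 3)]
    exact succ_add_pow_three_mul_le h

theorem two_pow_card_primeFactors_le {n : ℕ} (hn : n ≠ 0) :
    2 ^ n.primeFactors.card ≤ n.divisors.card := by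
  rw [Nat.card_divisors hn]
  refine Finset.pow_card_le_prod _ _ _ fun p hp => ?_
  have := (Nat.prime_of_mem_primeFactors hp).factorization_pos_of_dvd hn
    (Nat.dvd_of_mem_primeFactors hp)
  omega

/-! ### Rankin's trick for divisors with few divisors. -/

/-- Telescoping, from (k+2)^(t+2) ≥ 2^t (k+1)(k+2). -/
theorem sum_range_inv_succ_pow_le (t k : ℕ) :
    ∑ j ∈ Finset.range (k + 1), (((j : ℝ) + 1) ^ (t + 2))⁻¹ ≤
      1 + (2 ^ t)⁻¹ * (1 - ((k : ℝ) + 1)⁻¹) := by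
  induction k with
  | zero => simp
  | succ k ih =>
    rw [Finset.sum_range_succ]
    have h1 : (((k + 1 : ℕ) : ℝ) + 1) ^ (t + 2) ≥ 2 ^ t * ((k + 1) * (k + 2)) := by
      rw [pow_add]
      push_cast
      have hk : (0 : ℝ) ≤ k := k.cast_nonneg
      gcongr
      · linarith
      · nlinarith
    have h2 : ((((k + 1 : ℕ) : ℝ) + 1) ^ (t + 2))⁻¹ ≤ (2 ^ t * (((k : ℝ) + 1) * (k + 2)))⁻¹ :=
      inv_anti₀ (by positivity) h1
    have h3 : (2 ^ t * (((k : ℝ) + 1) * (k + 2)))⁻¹ =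
        (2 ^ t)⁻¹ * (((k : ℝ) + 1)⁻¹ - ((k : ℝ) + 2)⁻¹) := by
      field_simp
      ring
    push_cast
    push_cast at h2
    rw [h3] at h2
    rw [show (k : ℝ) + 1 + 1 = k + 2 by ring] at *
    linarith

/-- The sum is multiplicative in n and each local factor is at most 1 + 2^(-t), whatever the
exponent of the prime. Large t brings the base close to 1. -/
theorem sum_divisors_inv_card_divisors_pow_le (t : ℕ) {n : ℕ} (hn : n ≠ 0) :
    ∑ d ∈ n.divisors, ((d.divisors.card : ℝ) ^ (t + 2))⁻¹ ≤
      (1 + (2 ^ t)⁻¹) ^ n.primeFactors.card := by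
  induction n using Nat.recOnPosPrimePosCoprime with
  | zero => exact absurd rfl hn
  | one => simp
  | prime_pow p k hp hk =>
    rw [Nat.primeFactors_prime_pow hk.ne' hp, Finset.card_singleton, pow_one,
      Nat.sum_divisors_prime_pow hp]
    have : ∀ j, (p ^ j).divisors.card = j + 1 := fun j => by
      rw [Nat.divisors_prime_pow hp]; simp
    simp only [this]
    push_cast
    refine (sum_range_inv_succ_pow_le t k).trans ?_
    have : (0 : ℝ) ≤ ((k : ℝ) + 1)⁻¹ := by positivity
    have h2 : (0 : ℝ) ≤ (2 ^ t)⁻¹ := by positivity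
    nlinarith
  | coprime a b ha hb hab iha ihb =>
    rw [Nat.divisors_mul, Finset.mul_def, Finset.sum_image hab.mul_injOn_divisors,
      hab.primeFactors_mul,
      Finset.card_union_of_disjoint hab.disjoint_primeFactors, pow_add, Finset.sum_product]
    have : ∀ x ∈ a.divisors, ∀ y ∈ b.divisors,
        (((x * y).divisors.card : ℝ) ^ (t + 2))⁻¹ =
          ((x.divisors.card : ℝ) ^ (t + 2))⁻¹ * ((y.divisors.card : ℝ) ^ (t + 2))⁻¹ := by
      intro x hx y hy
      rw [Nat.Coprime.card_divisors_mul (hab.of_dvd (Nat.dvd_of_mem_divisors hx)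
        (Nat.dvd_of_mem_divisors hy))]
      push_cast
      rw [mul_pow, mul_inv]
    rw [Finset.sum_congr rfl fun x hx => Finset.sum_congr rfl (this x hx), ← Finset.sum_mul_sum]
    exact mul_le_mul (iha (by omega)) (ihb (by omega))
      (Finset.sum_nonneg fun _ _ => by positivity) (by positivity)

/-- Rankin's bound for the number of divisors of `n` having at most `T` divisors themselves. -/
theorem card_filter_card_divisors_le (t : ℕ) {n : ℕ} (hn : n ≠ 0) {T : ℝ} (hT : 0 ≤ T) :
    ((n.divisors.filter fun d => (d.divisors.card : ℝ) ≤ T).card : ℝ) ≤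
      T ^ (t + 2) * (1 + (2 ^ t)⁻¹) ^ n.primeFactors.card := by
  calc ((n.divisors.filter fun d => (d.divisors.card : ℝ) ≤ T).card : ℝ)
      = ∑ d ∈ n.divisors.filter fun d => (d.divisors.card : ℝ) ≤ T, (1 : ℝ) := by simp
    _ ≤ ∑ d ∈ n.divisors.filter fun d => (d.divisors.card : ℝ) ≤ T,
          T ^ (t + 2) * ((d.divisors.card : ℝ) ^ (t + 2))⁻¹ := by
        refine Finset.sum_le_sum fun d hd => ?_
        rw [Finset.mem_filter] at hd
        have hd0 : 0 < d.divisors.card :=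
          Finset.card_pos.2 (Nat.nonempty_divisors.2 (Nat.pos_of_mem_divisors hd.1).ne')
        have : (0 : ℝ) < d.divisors.card := by exact_mod_cast hd0
        rw [← div_eq_mul_inv, one_le_div (by positivity)]
        exact pow_le_pow_left₀ this.le hd.2 _
    _ ≤ ∑ d ∈ n.divisors, T ^ (t + 2) * ((d.divisors.card : ℝ) ^ (t + 2))⁻¹ :=
        Finset.sum_le_sum_of_subset_of_nonneg (Finset.filter_subset _ _)
          fun _ _ _ => by positivity
    _ ≤ _ := by
        rw [← Finset.mul_sum]
        gcongr
        exact sum_divisors_inv_card_divisors_pow_le t hn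

/-- A prime p ≥ K with exponent e contributes e + 1 ≤ 2^e ≤ p^(δe); each of the fewer than K smaller
primes costs an extra factor M. -/
theorem card_divisors_le_rpow_mul {δ M : ℝ} (hM : 1 ≤ M)
    (hM' : ∀ e : ℕ, (e : ℝ) + 1 ≤ M * 2 ^ (δ * e)) {K : ℕ}
    (hδ : 0 ≤ δ) (hK : ∀ p : ℕ, K ≤ p → (2 : ℝ) ≤ (p : ℝ) ^ δ) {n : ℕ} (hn : n ≠ 0) :
    (n.divisors.card : ℝ) ≤ (n : ℝ) ^ δ * M ^ K := by
  have hprod : (n : ℝ) ^ δ = ∏ p ∈ n.primeFactors, (p : ℝ) ^ (δ * n.factorization p) := by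
    conv_lhs => rw [← Nat.prod_factorization_pow_eq_self hn]
    rw [Finsupp.prod, Nat.support_factorization, Nat.cast_prod,
      ← Real.finsetProd_rpow _ _ fun _ _ => by positivity]
    refine Finset.prod_congr rfl fun p _ => ?_
    rw [Nat.cast_pow, ← Real.rpow_natCast, ← Real.rpow_mul p.cast_nonneg, mul_comm]
  have hM_prod : ∏ p ∈ n.primeFactors, (if p < K then M else 1) ≤ M ^ K := by
    rw [← Finset.prod_filter, Finset.prod_const]
    refine pow_le_pow_right₀ hM ?_
    calc _ ≤ (Finset.range K).card := Finset.card_le_card fun p hp => by simp_all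
      _ = K := Finset.card_range K
  rw [Nat.card_divisors hn, hprod]
  refine le_trans ?_ (mul_le_mul_of_nonneg_left hM_prod
    (Finset.prod_nonneg fun _ _ => by positivity))
  rw [← Finset.prod_mul_distrib]
  push_cast
  refine Finset.prod_le_prod (fun _ _ => by positivity) fun p hp => ?_
  have hp2 : (2 : ℝ) ≤ p := by exact_mod_cast (Nat.prime_of_mem_primeFactors hp).two_le
  split_ifs with h
  · refine (hM' _).trans ?_
    rw [mul_comm]
    gcongr
  · rw [mul_one, Real.rpow_mul (by positivity), Real.rpow_natCast]
    calc ((n.factorization p : ℝ) + 1) ≤ 2 ^ n.factorization p := by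
          exact_mod_cast Nat.lt_two_pow_self
      _ ≤ _ := by
          gcongr
          exact hK p (not_lt.1 h)

/-! ### Energy and quotient counting. -/

/-- In ab = a'b', a' is a divisor of ab, and a, b, a' determine b'. -/
theorem mulEnergy_le_sum_card_divisors {A B : Finset ℕ} (hA : ∀ a ∈ A, a ≠ 0)
    (hB : ∀ b ∈ B, b ≠ 0) :
    Finset.mulEnergy A B ≤ ∑ p ∈ A ×ˢ B, (p.1 * p.2).divisors.card := by
  rw [← Finset.card_sigma]
  refine Finset.card_le_card_of_injOn (fun x => ⟨(x.1.1, x.2.1), x.1.2⟩) ?_ ?_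
  · rintro ⟨⟨a, a'⟩, b, b'⟩ hx
    simp only [Finset.coe_filter, Finset.mem_product, Set.mem_ofPred_eq] at hx
    obtain ⟨⟨⟨ha, ha'⟩, hb, hb'⟩, h⟩ := hx
    simp only [Finset.coe_sigma, Set.mem_sigma_iff, Finset.mem_coe, Finset.mem_product,
      Nat.mem_divisors]
    exact ⟨⟨ha, hb⟩, h ▸ dvd_mul_right _ _, mul_ne_zero (hA a ha) (hB b hb)⟩
  · rintro ⟨⟨a, a'⟩, b, b'⟩ hx ⟨⟨c, c'⟩, d, d'⟩ hy h
    simp only [Finset.coe_filter, Finset.mem_product, Set.mem_ofPred_eq] at hx hy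
    simp only [Sigma.mk.injEq, Prod.mk.injEq, heq_eq_eq] at h
    obtain ⟨⟨rfl, rfl⟩, rfl⟩ := h
    have : b' = d' := Nat.eq_of_mul_eq_mul_left (Nat.pos_of_ne_zero (hA _ hx.1.1.2))
      (hx.2.symm.trans hy.2)
    simp [this]

theorem card_sq_le_card_image_mul {α β : Type*} [DecidableEq β] (G : Finset α) (f : α → β) :
    G.card ^ 2 ≤ (G.image f).card * ((G ×ˢ G).filter fun x => f x.1 = f x.2).card := by
  have h1 : G.card = ∑ q ∈ G.image f, (G.filter fun x => f x = q).card :=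
    Finset.card_eq_sum_card_fiberwise fun x hx => Finset.mem_coe.2 (Finset.mem_image_of_mem f hx)
  have h2 : ((G ×ˢ G).filter fun x => f x.1 = f x.2).card =
      ∑ q ∈ G.image f, (G.filter fun x => f x = q).card ^ 2 := by
    rw [Finset.card_eq_sum_card_fiberwise (f := fun x => f x.1) (t := G.image f)]
    · refine Finset.sum_congr rfl fun q _ => ?_
      rw [sq, ← Finset.card_product]
      congr 1
      ext ⟨x, y⟩
      simp only [Finset.mem_filter, Finset.mem_product]
      constructor
      · rintro ⟨⟨⟨hx, hy⟩, h⟩, rfl⟩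
        exact ⟨⟨hx, rfl⟩, hy, h.symm⟩
      · rintro ⟨⟨hx, rfl⟩, hy, h⟩
        exact ⟨⟨⟨hx, hy⟩, h.symm⟩, rfl⟩
    · intro x hx
      have := (Finset.mem_product.1 (Finset.mem_filter.1 (Finset.mem_coe.1 hx)).1).1
      exact Finset.mem_coe.2 (Finset.mem_image_of_mem f this)
  rw [h2, h1]
  exact_mod_cast sq_sum_le_card_mul_sum_sq

theorem card_divisors_mono {m n : ℕ} (hn : n ≠ 0) (h : m ∣ n) :
    m.divisors.card ≤ n.divisors.card :=
  Finset.card_le_card (Nat.divisors_subset_of_dvd hn h)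

theorem eq_of_div_gcd_eq {a b c : ℕ} (ha : 0 < a) (h₁ : a / a.gcd b = a / a.gcd c)
    (h₂ : b / a.gcd b = c / a.gcd c) : b = c := by
  have hpos : 0 < a / a.gcd b :=
    Nat.div_pos (Nat.gcd_le_left _ ha) (Nat.gcd_pos_of_pos_left b ha)
  have hgcd : a.gcd b = a.gcd c := by
    refine Nat.eq_of_mul_eq_mul_left hpos ?_
    rw [Nat.div_mul_cancel (Nat.gcd_dvd_left a b), h₁, Nat.div_mul_cancel (Nat.gcd_dvd_left a c)]
  calc b = b / a.gcd b * a.gcd b := (Nat.div_mul_cancel (Nat.gcd_dvd_right a b)).symm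
    _ = c / a.gcd c * a.gcd c := by rw [h₂, hgcd]
    _ = c := Nat.div_mul_cancel (Nat.gcd_dvd_right a c)

/-- With u/v the reduced form of a/a', the solution ab' = a'b is encoded by (a, b', u, v).
Coprimality gives u ∣ b and v ∣ b', so u ∣ gcd(a,b) and v ∣ gcd(a',b') inherit the bound T. To
decode, a, u, v give a', and then the equation gives b. -/
theorem card_filter_mul_eq_mul_le {A B : Finset ℕ} (hA : ∀ a ∈ A, a ≠ 0) (hB : ∀ b ∈ B, b ≠ 0)
    {T : ℝ} {D : ℕ}
    (hAD : ∀ a ∈ A, (a.divisors.filter fun d => (d.divisors.card : ℝ) ≤ T).card ≤ D)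
    (hBD : ∀ b ∈ B, (b.divisors.filter fun d => (d.divisors.card : ℝ) ≤ T).card ≤ D)
    {G : Finset (ℕ × ℕ)} (hG : G ⊆ A ×ˢ B)
    (hGT : ∀ p ∈ G, ((p.1.gcd p.2).divisors.card : ℝ) ≤ T) :
    ((G ×ˢ G).filter fun x => x.1.1 * x.2.2 = x.2.1 * x.1.2).card ≤
      A.card * B.card * D ^ 2 := by
  set F : ℕ → Finset ℕ := fun n => n.divisors.filter fun d => (d.divisors.card : ℝ) ≤ T with hF
  have hcard : ((A ×ˢ B).sigma fun p => F p.1 ×ˢ F p.2).card ≤ A.card * B.card * D ^ 2 := by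
    rw [Finset.card_sigma, ← Finset.card_product, ← smul_eq_mul]
    refine Finset.sum_le_card_nsmul _ _ _ fun p hp => ?_
    rw [Finset.mem_product] at hp
    rw [Finset.card_product, sq]
    exact Nat.mul_le_mul (hAD _ hp.1) (hBD _ hp.2)
  refine le_trans ?_ hcard
  have key : ∀ a b a' b' : ℕ, a ≠ 0 → a' ≠ 0 → a * b' = a' * b →
      a / a.gcd a' ∣ b ∧ a' / a.gcd a' ∣ b' := by
    intro a b a' b' ha ha' h
    have hg : 0 < a.gcd a' := Nat.gcd_pos_of_pos_left _ (Nat.pos_of_ne_zero ha)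
    have hco : (a / a.gcd a').Coprime (a' / a.gcd a') := Nat.coprime_div_gcd_div_gcd hg
    have h' : a / a.gcd a' * b' = a' / a.gcd a' * b := by
      refine Nat.eq_of_mul_eq_mul_left hg ?_
      rw [← mul_assoc, ← mul_assoc, Nat.mul_div_cancel' (Nat.gcd_dvd_left _ _),
        Nat.mul_div_cancel' (Nat.gcd_dvd_right _ _), h]
    exact ⟨hco.dvd_of_dvd_mul_left (h' ▸ dvd_mul_right _ _),
      hco.symm.dvd_of_dvd_mul_left (h'.symm ▸ dvd_mul_right _ _)⟩
  refine Finset.card_le_card_of_injOn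
    (fun x => ⟨(x.1.1, x.2.2), (x.1.1 / x.1.1.gcd x.2.1, x.2.1 / x.1.1.gcd x.2.1)⟩) ?_ ?_
  · rintro ⟨⟨a, b⟩, a', b'⟩ hx
    simp only [Finset.coe_filter, Finset.mem_product, Set.mem_ofPred_eq] at hx
    obtain ⟨⟨h1, h2⟩, h⟩ := hx
    have m1 := Finset.mem_product.1 (hG h1)
    have m2 := Finset.mem_product.1 (hG h2)
    simp only at m1 m2
    have ha := hA a m1.1
    have hb := hB b m1.2
    have ha' := hA a' m2.1
    have hb' := hB b' m2.2
    obtain ⟨k1, k2⟩ := key a b a' b' ha ha' h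
    have d1 : a / a.gcd a' ∣ a := Nat.div_dvd_of_dvd (Nat.gcd_dvd_left _ _)
    have d2 : a' / a.gcd a' ∣ a' := Nat.div_dvd_of_dvd (Nat.gcd_dvd_right _ _)
    have g1 : a.gcd b ≠ 0 := (Nat.gcd_pos_of_pos_left _ (Nat.pos_of_ne_zero ha)).ne'
    have g2 : a'.gcd b' ≠ 0 := (Nat.gcd_pos_of_pos_left _ (Nat.pos_of_ne_zero ha')).ne'
    simp only [Finset.coe_sigma, Set.mem_sigma_iff, Finset.mem_coe, Finset.mem_product, hF,
      Finset.mem_filter, Nat.mem_divisors]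
    have t1 : ((a.gcd b).divisors.card : ℝ) ≤ T := hGT (a, b) h1
    have t2 : ((a'.gcd b').divisors.card : ℝ) ≤ T := hGT (a', b') h2
    replace t1 := le_trans
      ((Nat.cast_le (α := ℝ)).2 (card_divisors_mono g1 (Nat.dvd_gcd d1 k1))) t1
    replace t2 := le_trans
      ((Nat.cast_le (α := ℝ)).2 (card_divisors_mono g2 (Nat.dvd_gcd d2 k2))) t2
    exact ⟨⟨m1.1, m2.2⟩, ⟨⟨d1, ha⟩, t1⟩, ⟨k2, hb'⟩, t2⟩
  · rintro ⟨⟨a, b⟩, a', b'⟩ hx ⟨⟨c, d⟩, c', d'⟩ hy h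
    have hx := Finset.mem_filter.1 (Finset.mem_coe.1 hx)
    have hy := Finset.mem_filter.1 (Finset.mem_coe.1 hy)
    have hx1 := Finset.mem_product.1 hx.1
    have hx2 := hx.2
    have hy2 := hy.2
    dsimp only at hx1 hx2 hy2
    have ha := hA a (Finset.mem_product.1 (hG hx1.1)).1
    have ha' := hA a' (Finset.mem_product.1 (hG hx1.2)).1
    clear hx hy hx1
    simp only [Sigma.mk.injEq, Prod.mk.injEq, heq_eq_eq] at h
    obtain ⟨⟨rfl, rfl⟩, hu, hv⟩ := h
    obtain rfl := eq_of_div_gcd_eq (Nat.pos_of_ne_zero ha) hu hv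
    have : b = d := Nat.eq_of_mul_eq_mul_left (Nat.pos_of_ne_zero ha') (hx2.symm.trans hy2)
    rw [this]

theorem quotientSet_eq_image {A B : Finset ℕ} (hB : ∀ b ∈ B, b ≠ 0) :
    quotientSet A B = (A ×ˢ B).image fun p => (p.1 : ℚ) / p.2 := by
  rw [quotientSet, Finset.filter_true_of_mem hB, Finset.image₂]
  rfl

theorem card_quotientSet_le (A B : Finset ℕ) : (quotientSet A B).card ≤ A.card * B.card :=
  Finset.card_image₂_le _ _ _ |>.trans
    (Nat.mul_le_mul_left _ (Finset.card_le_card (Finset.filter_subset _ _)))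

/-- A dense set of pairs with few common divisors forces a large quotient set. -/
theorem card_sq_le_card_quotientSet_mul {A B : Finset ℕ} (hA : ∀ a ∈ A, a ≠ 0)
    (hB : ∀ b ∈ B, b ≠ 0) {T : ℝ} {D : ℕ}
    (hAD : ∀ a ∈ A, (a.divisors.filter fun d => (d.divisors.card : ℝ) ≤ T).card ≤ D)
    (hBD : ∀ b ∈ B, (b.divisors.filter fun d => (d.divisors.card : ℝ) ≤ T).card ≤ D)
    {G : Finset (ℕ × ℕ)} (hG : G ⊆ A ×ˢ B)
    (hGT : ∀ p ∈ G, ((p.1.gcd p.2).divisors.card : ℝ) ≤ T) :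
    G.card ^ 2 ≤ (quotientSet A B).card * (A.card * B.card * D ^ 2) := by
  refine (card_sq_le_card_image_mul G fun p => (p.1 : ℚ) / p.2).trans (Nat.mul_le_mul ?_ ?_)
  · rw [quotientSet_eq_image hB]
    exact Finset.card_le_card (Finset.image_subset_image hG)
  · refine le_trans (Finset.card_le_card fun x hx => ?_)
      (card_filter_mul_eq_mul_le hA hB hAD hBD hG hGT)
    simp only [Finset.mem_filter, Finset.mem_product] at hx ⊢
    refine ⟨hx.1, ?_⟩
    have h1 : (x.1.2 : ℚ) ≠ 0 := Nat.cast_ne_zero.2 (hB _ (Finset.mem_product.1 (hG hx.1.1)).2)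
    have h2 : (x.2.2 : ℚ) ≠ 0 := Nat.cast_ne_zero.2 (hB _ (Finset.mem_product.1 (hG hx.1.2)).2)
    have := (div_eq_div_iff h1 h2).1 hx.2
    exact_mod_cast this

/-! ### Wigert's theorem and growth of L. -/

/-- **Wigert's theorem**: the maximal order of the divisor function. -/
theorem eventually_card_divisors_le {ε : ℝ} (hε : 0 < ε) :
    ∀ᶠ x : ℝ in atTop, ∀ n : ℕ, n ≠ 0 → (n : ℝ) ≤ x →
      (n.divisors.card : ℝ) ≤
        Real.exp ((Real.log 2 + ε) * (Real.log x / Real.log (Real.log x))) := by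
  have hlog2 : 0 < Real.log 2 := Real.log_pos one_lt_two
  have hlog2' : 1 / 2 < Real.log 2 := by linarith [Real.log_two_gt_d9]
  set c := Real.log 2 + ε / 2 with hc
  have hc0 : 0 < c := by positivity
  set θ := Real.log 2 / c with hθ
  have hθ1 : 0 < 1 - θ := by
    rw [sub_pos, hθ, div_lt_one hc0]
    linarith
  have hθ0 : 0 < θ := by positivity
  have hz : Tendsto (fun x : ℝ => Real.log (Real.log x)) atTop atTop :=
    Real.tendsto_log_atTop.comp Real.tendsto_log_atTop
  -- With z = log log x, the cutoff K is about (log x)^θ with θ < 1, and δ = c/z makes the cutoff to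
  -- the power δ exactly 2. The small primes then cost exp(O((log x)^θ z)), to be compared with
  -- exp(ε/2 · log x / z): hence the power z².
  have hsmall := (isLittleO_pow_exp_pos_mul_atTop 2 hθ1).def
    (show (0 : ℝ) < c * (ε / 2) / 4 by positivity)
  filter_upwards [hz.eventually (eventually_ge_atTop (max 1 c)), hz.eventually hsmall,
    Real.tendsto_log_atTop.eventually (eventually_gt_atTop 0), eventually_gt_atTop 0]
    with x hx1 hx2 hlogx hx0 n hn hnx
  set z := Real.log (Real.log x) with hzdef
  have hz1 : 1 ≤ z := (le_max_left _ _).trans hx1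
  have hzc : c ≤ z := (le_max_right _ _).trans hx1
  have hz0 : 0 < z := by linarith
  have hez : Real.exp z = Real.log x := Real.exp_log hlogx
  set δ := c / z with hδ
  have hδ0 : 0 < δ := by positivity
  have hδ1 : δ ≤ 1 := (div_le_one hz0).2 hzc
  have hM : 1 ≤ 2 / δ := by rw [le_div_iff₀ hδ0]; linarith
  set K := ⌈Real.exp (θ * z)⌉₊ with hKdef
  have hK : ∀ p : ℕ, K ≤ p → (2 : ℝ) ≤ (p : ℝ) ^ δ := by
    intro p hp
    have hp' : Real.exp (θ * z) ≤ p := Nat.ceil_le.1 hp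
    calc (2 : ℝ) = Real.exp (θ * z) ^ δ := by
          rw [← Real.exp_mul, show θ * z * δ = Real.log 2 by rw [hθ, hδ]; field_simp,
            Real.exp_log two_pos]
      _ ≤ _ := Real.rpow_le_rpow (Real.exp_pos _).le hp' hδ0.le
  have hM' : ∀ e : ℕ, (e : ℝ) + 1 ≤ 2 / δ * 2 ^ (δ * e) := by
    intro e
    have h1 : 1 + δ * e / 2 ≤ (2 : ℝ) ^ (δ * e) := by
      rw [Real.rpow_def_of_pos two_pos]
      have h := Real.add_one_le_exp (Real.log 2 * (δ * e))
      have h' : 0 ≤ δ * e := by positivity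
      nlinarith
    calc (e : ℝ) + 1 ≤ e + 2 / δ := by linarith
      _ = 2 / δ * (1 + δ * e / 2) := by field_simp; ring
      _ ≤ _ := by gcongr
  have hKle : (K : ℝ) ≤ 2 * Real.exp (θ * z) := by
    have h1 := Nat.ceil_lt_add_one (Real.exp_pos (θ * z)).le
    have h2 : 1 ≤ Real.exp (θ * z) := Real.one_le_exp (by positivity)
    linarith
  refine (card_divisors_le_rpow_mul hM hM' hδ0.le hK hn).trans ?_
  have hfirst : (n : ℝ) ^ δ ≤ Real.exp (c * (Real.log x / z)) := by
    calc (n : ℝ) ^ δ ≤ x ^ δ := Real.rpow_le_rpow n.cast_nonneg hnx hδ0.le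
      _ = _ := by
        rw [Real.rpow_def_of_pos hx0, hδ]
        congr 1
        ring
  have hsecond : (2 / δ) ^ K ≤ Real.exp (ε / 2 * (Real.log x / z)) := by
    have hlogM : 2 / δ ≤ Real.exp (2 / δ) := by linarith [Real.add_one_le_exp (2 / δ)]
    calc (2 / δ) ^ K ≤ Real.exp (2 / δ) ^ K := pow_le_pow_left₀ (by positivity) hlogM _
      _ = Real.exp (K * (2 / δ)) := (Real.exp_nat_mul _ _).symm
      _ ≤ _ := by
        rw [Real.exp_le_exp]
        rw [Real.norm_of_nonneg (by positivity), Real.norm_of_nonneg (Real.exp_pos _).le] at hx2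
        have hsplit : Real.exp (θ * z) * Real.exp ((1 - θ) * z) = Real.log x := by
          rw [← Real.exp_add, ← hez]; congr 1; ring
        calc (K : ℝ) * (2 / δ) ≤ 2 * Real.exp (θ * z) * (2 / δ) := by gcongr
          _ = 4 / c / z * (Real.exp (θ * z) * z ^ 2) := by rw [hδ]; field_simp; ring
          _ ≤ 4 / c / z * (Real.exp (θ * z) *
                (c * (ε / 2) / 4 * Real.exp ((1 - θ) * z))) := by gcongr
          _ = 4 / c / z * (c * (ε / 2) / 4) *
                (Real.exp (θ * z) * Real.exp ((1 - θ) * z)) := by ring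
          _ = _ := by rw [hsplit]; field_simp
  calc (n : ℝ) ^ δ * (2 / δ) ^ K
      ≤ Real.exp (c * (Real.log x / z)) * Real.exp (ε / 2 * (Real.log x / z)) := by gcongr
    _ = _ := by rw [← Real.exp_add, hc]; congr 1; ring

theorem tendsto_log_div_log_log :
    Tendsto (fun x : ℝ => Real.log x / Real.log (Real.log x)) atTop atTop := by
  have h : Tendsto (fun y : ℝ => y / Real.log y) atTop atTop := by
    have h0 : Tendsto (fun y : ℝ => Real.log y / y) atTop (𝓝[>] 0) := by
      refine tendsto_nhdsWithin_iff.2 ⟨Real.isLittleO_log_id_atTop.tendsto_div_nhds_zero, ?_⟩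
      filter_upwards [eventually_gt_atTop 1] with y hy
      exact div_pos (Real.log_pos hy) (by linarith)
    refine (tendsto_inv_nhdsGT_zero.comp h0).congr fun y => ?_
    simp
  exact h.comp Real.tendsto_log_atTop

/-! ### Explicit estimates at a fixed scale L. -/

theorem card_primeFactors_le_of_card_divisors_le {n : ℕ} (hn : n ≠ 0) {L : ℝ}
    (h : (n.divisors.card : ℝ) ≤ Real.exp (2 * Real.log 2 * L)) :
    (n.primeFactors.card : ℝ) ≤ 2 * L := by
  have h1 : (2 : ℝ) ^ n.primeFactors.card ≤ Real.exp (2 * Real.log 2 * L) :=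
    le_trans (by exact_mod_cast two_pow_card_primeFactors_le hn) h
  have h2 : (2 : ℝ) ^ n.primeFactors.card = Real.exp (n.primeFactors.card * Real.log 2) := by
    rw [Real.exp_nat_mul, Real.exp_log two_pos]
  rw [h2, Real.exp_le_exp] at h1
  have hlog2 : 0 < Real.log 2 := Real.log_pos one_lt_two
  nlinarith

/-- Both terms of the exponent become small when t is taken large first and κ small in terms of t.
-/
theorem card_filter_card_divisors_le_exp (t : ℕ) {n : ℕ} (hn : n ≠ 0) {L κ : ℝ}
    (h : (n.divisors.card : ℝ) ≤ Real.exp (2 * Real.log 2 * L)) :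
    ((n.divisors.filter fun d => (d.divisors.card : ℝ) ≤ Real.exp (κ * L)).card : ℝ) ≤
      Real.exp (((t + 2 : ℕ) * κ + 2 * (2 ^ t)⁻¹) * L) := by
  refine (card_filter_card_divisors_le t hn (Real.exp_pos _).le).trans ?_
  have h1 : (1 + ((2 : ℝ) ^ t)⁻¹) ^ n.primeFactors.card ≤ Real.exp (2 * (2 ^ t)⁻¹ * L) := by
    calc (1 + ((2 : ℝ) ^ t)⁻¹) ^ n.primeFactors.card
        ≤ Real.exp ((2 ^ t)⁻¹) ^ n.primeFactors.card :=
          pow_le_pow_left₀ (by positivity) (by linarith [Real.add_one_le_exp ((2 : ℝ) ^ t)⁻¹]) _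
      _ = Real.exp (n.primeFactors.card * (2 ^ t)⁻¹) := (Real.exp_nat_mul _ _).symm
      _ ≤ _ := by
        rw [Real.exp_le_exp, show 2 * ((2 : ℝ) ^ t)⁻¹ * L = 2 * L * (2 ^ t)⁻¹ by ring]
        exact mul_le_mul_of_nonneg_right (card_primeFactors_le_of_card_divisors_le hn h)
          (by positivity)
  calc _ ≤ Real.exp (κ * L) ^ (t + 2) * Real.exp (2 * (2 ^ t)⁻¹ * L) := by gcongr
    _ = _ := by
      rw [← Real.exp_nat_mul, ← Real.exp_add]
      congr 1
      ring

/-- If the energy is nearly maximal, then a dense set of pairs has few common divisors. -/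
theorem le_card_filter_card_divisors_gcd {A B : Finset ℕ} (hA : ∀ a ∈ A, a ≠ 0)
    (hB : ∀ b ∈ B, b ≠ 0) {L κ : ℝ} (hL : 2 ≤ Real.exp (κ / 12 * L))
    (hAτ : ∀ a ∈ A, (a.divisors.card : ℝ) ≤ Real.exp ((Real.log 2 + κ / 12) * L))
    (hBτ : ∀ b ∈ B, (b.divisors.card : ℝ) ≤ Real.exp ((Real.log 2 + κ / 12) * L))
    (hE : (A.card * B.card : ℝ) * Real.exp ((2 * Real.log 2 - κ / 12) * L) ≤
      Finset.mulEnergy A B) :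
    (A.card * B.card : ℝ) * Real.exp (-(κ / 3) * L) ≤
      ((A ×ˢ B).filter fun p =>
        ((p.1.gcd p.2).divisors.card : ℝ) ≤ Real.exp (κ * L)).card := by
  set G := (A ×ˢ B).filter fun p =>
    ((p.1.gcd p.2).divisors.card : ℝ) ≤ Real.exp (κ * L) with hG
  set N : ℝ := (A.card * B.card : ℝ) with hN
  have hN0 : 0 ≤ N := by positivity
  -- Y bounds τ(ab) when τ(gcd) exceeds exp(κL): one third of 6(log 2 + κ/12) - κ is 2 log 2 - κ/6.
  -- This is κ/12 below the exponent in `hE`, so such pairs carry at most half of that lower bound.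
  set Y := Real.exp ((2 * Real.log 2 - κ / 6) * L) with hY
  set X := Real.exp ((2 * Real.log 2 + κ / 6) * L) with hX
  have hbound : ∀ p ∈ A ×ˢ B, ((p.1 * p.2).divisors.card : ℝ) ≤
      (if ((p.1.gcd p.2).divisors.card : ℝ) ≤ Real.exp (κ * L) then X else 0) + Y := by
    intro p hp
    obtain ⟨h1, h2⟩ := Finset.mem_product.1 hp
    split_ifs with h
    · have : ((p.1 * p.2).divisors.card : ℝ) ≤ p.1.divisors.card * p.2.divisors.card := by
        exact_mod_cast card_divisors_mul_le (hA _ h1) (hB _ h2)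
      calc _ ≤ _ := this
        _ ≤ Real.exp ((Real.log 2 + κ / 12) * L) * Real.exp ((Real.log 2 + κ / 12) * L) :=
          mul_le_mul (hAτ _ h1) (hBτ _ h2) (Nat.cast_nonneg _) (Real.exp_pos _).le
        _ = X := by rw [← Real.exp_add, hX]; congr 1; ring
        _ ≤ X + Y := le_add_of_nonneg_right (Real.exp_pos _).le
    · rw [zero_add]
      have h3 : ((p.1 * p.2).divisors.card : ℝ) ^ 3 * (p.1.gcd p.2).divisors.card ≤
          (p.1.divisors.card : ℝ) ^ 3 * (p.2.divisors.card : ℝ) ^ 3 := by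
        exact_mod_cast card_divisors_mul_pow_three_mul_gcd_le (hA _ h1) (hB _ h2)
      have h4 : ((p.1 * p.2).divisors.card : ℝ) ^ 3 * Real.exp (κ * L) ≤
          Y ^ 3 * Real.exp (κ * L) := by
        calc _ ≤ ((p.1 * p.2).divisors.card : ℝ) ^ 3 * (p.1.gcd p.2).divisors.card := by
              gcongr
              exact (not_le.1 h).le
          _ ≤ _ := h3
          _ ≤ Real.exp ((Real.log 2 + κ / 12) * L) ^ 3 *
                Real.exp ((Real.log 2 + κ / 12) * L) ^ 3 := by
              gcongr
              · exact hAτ _ h1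
              · exact hBτ _ h2
          _ = _ := by
              rw [hY, ← Real.exp_nat_mul, ← Real.exp_nat_mul, ← Real.exp_add, ← Real.exp_add]
              congr 1
              push_cast
              ring
      exact le_of_pow_le_pow_left₀ three_ne_zero (Real.exp_pos _).le
        (le_of_mul_le_mul_right h4 (Real.exp_pos _))
  have hsum : (Finset.mulEnergy A B : ℝ) ≤ G.card * X + N * Y := by
    calc (Finset.mulEnergy A B : ℝ)
        ≤ ∑ p ∈ A ×ˢ B, ((p.1 * p.2).divisors.card : ℝ) := by
          exact_mod_cast mulEnergy_le_sum_card_divisors hA hB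
      _ ≤ _ := Finset.sum_le_sum hbound
      _ = _ := by
          rw [Finset.sum_add_distrib, ← Finset.sum_filter, Finset.sum_const, Finset.sum_const,
            Finset.card_product, nsmul_eq_mul, nsmul_eq_mul, Nat.cast_mul]
  have hYe : Real.exp ((2 * Real.log 2 - κ / 12) * L) = Real.exp (κ / 12 * L) * Y := by
    rw [hY, ← Real.exp_add]; congr 1; ring
  have hYX : X * Real.exp (κ / 12 * L) * Real.exp (-(κ / 3) * L) =
      Real.exp (κ / 12 * L) * Y := by
    rw [hY, hX, ← Real.exp_add, ← Real.exp_add, ← Real.exp_add]; congr 1; ring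
  rw [hYe] at hE
  set e := Real.exp (κ / 12 * L) with he
  have hY0 : 0 < Y := Real.exp_pos _
  have hX0 : 0 < X := Real.exp_pos _
  have hNY : 2 * (N * Y) ≤ N * (e * Y) := by nlinarith [mul_nonneg hN0 hY0.le]
  have h5 : N * (e * Y) ≤ 2 * (G.card * X) := by linarith
  have h6 : 2 * (G.card * X) ≤ e * (G.card * X) := by gcongr
  have h7 : (N * Real.exp (-(κ / 3) * L)) * (X * e) ≤ G.card * (X * e) := by
    calc _ = N * (X * e * Real.exp (-(κ / 3) * L)) := by ring
      _ = N * (e * Y) := by rw [hYX]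
      _ ≤ e * (G.card * X) := h5.trans h6
      _ = _ := by ring
  exact le_of_mul_le_mul_right h7 (by positivity)

theorem le_card_quotientSet {A B : Finset ℕ} (hA : ∀ a ∈ A, a ≠ 0)
    (hB : ∀ b ∈ B, b ≠ 0) {L κ : ℝ} (t : ℕ) (hκ : κ / 12 ≤ Real.log 2)
    (hL0 : 0 ≤ L) (hL : 2 ≤ Real.exp (κ / 12 * L))
    (hAτ : ∀ a ∈ A, (a.divisors.card : ℝ) ≤ Real.exp ((Real.log 2 + κ / 12) * L))
    (hBτ : ∀ b ∈ B, (b.divisors.card : ℝ) ≤ Real.exp ((Real.log 2 + κ / 12) * L))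
    (hE : (A.card * B.card : ℝ) * Real.exp ((2 * Real.log 2 - κ / 12) * L) ≤
      Finset.mulEnergy A B) :
    (A.card * B.card : ℝ) * Real.exp (-(2 * (t + 3) * κ + 4 * (2 ^ t)⁻¹) * L) ≤
      (quotientSet A B).card := by
  have hκ0 : 0 ≤ κ * L := by
    have : 0 < κ / 12 * L := by
      rw [← Real.exp_lt_exp, Real.exp_zero]; linarith
    linarith
  have hG := le_card_filter_card_divisors_gcd hA hB hL hAτ hBτ hE
  set G := (A ×ˢ B).filter fun p =>
    ((p.1.gcd p.2).divisors.card : ℝ) ≤ Real.exp (κ * L) with hGdef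
  set N : ℝ := (A.card * B.card : ℝ) with hN
  set R := Real.exp (((t + 2 : ℕ) * κ + 2 * (2 ^ t)⁻¹) * L) with hR
  have hexp : Real.exp ((Real.log 2 + κ / 12) * L) ≤ Real.exp (2 * Real.log 2 * L) := by
    gcongr
    linarith
  have hdiv : ∀ n : ℕ, n ≠ 0 → (n.divisors.card : ℝ) ≤ Real.exp ((Real.log 2 + κ / 12) * L) →
      (n.divisors.filter fun d => (d.divisors.card : ℝ) ≤ Real.exp (κ * L)).card ≤ ⌊R⌋₊ :=
    fun n hn h => Nat.le_floor (card_filter_card_divisors_le_exp t hn (h.trans hexp))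
  have hmain := card_sq_le_card_quotientSet_mul hA hB
    (fun a ha => hdiv a (hA a ha) (hAτ a ha)) (fun b hb => hdiv b (hB b hb) (hBτ b hb))
    (Finset.filter_subset _ _) (fun p hp => (Finset.mem_filter.1 hp).2) (G := G)
  have hfloor : ((⌊R⌋₊ : ℕ) : ℝ) ≤ R := Nat.floor_le (Real.exp_pos _).le
  have hmain' : (G.card : ℝ) ^ 2 ≤ (quotientSet A B).card * (N * R ^ 2) := by
    calc (G.card : ℝ) ^ 2 ≤ (quotientSet A B).card * (N * (⌊R⌋₊ : ℝ) ^ 2) := by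
          rw [hN]
          exact_mod_cast hmain
      _ ≤ _ := by gcongr
  have hN0 : 0 ≤ N := by positivity
  rcases hN0.eq_or_lt with h0 | hpos
  · rw [← h0, zero_mul]
    exact Nat.cast_nonneg _
  have hsq : (N * Real.exp (-(κ / 3) * L)) ^ 2 ≤ (G.card : ℝ) ^ 2 :=
    pow_le_pow_left₀ (by positivity) hG 2
  have hle : Real.exp (-(2 * (t + 3) * κ + 4 * (2 ^ t)⁻¹) * L) * R ^ 2 ≤
      Real.exp (-(κ / 3) * L) ^ 2 := by
    rw [hR, ← Real.exp_nat_mul, ← Real.exp_nat_mul, ← Real.exp_add, Real.exp_le_exp]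
    push_cast
    nlinarith
  refine le_of_mul_le_mul_right (a := N * R ^ 2) ?_ (by positivity)
  calc _ = N ^ 2 * (Real.exp (-(2 * (t + 3) * κ + 4 * (2 ^ t)⁻¹) * L) * R ^ 2) := by ring
    _ ≤ N ^ 2 * Real.exp (-(κ / 3) * L) ^ 2 := by gcongr
    _ = (N * Real.exp (-(κ / 3) * L)) ^ 2 := by ring
    _ ≤ _ := hsq.trans hmain'

theorem eventually_le_card_quotientSet {ι : Type*} {l : Filter ι} {Q : ι → ℝ}
    (hQ : Tendsto Q l atTop) {A B : ι → Finset ℕ}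
    (hA : ∀ i, ∀ a ∈ A i, 1 ≤ a ∧ (a : ℝ) ≤ Q i)
    (hB : ∀ i, ∀ b ∈ B i, 1 ≤ b ∧ (b : ℝ) ≤ Q i)
    (hE : ∀ η > 0, ∀ᶠ i in l, ((A i).card * (B i).card : ℝ) *
      Real.exp ((2 * Real.log 2 - η) * (Real.log (Q i) / Real.log (Real.log (Q i)))) ≤
        Finset.mulEnergy (A i) (B i))
    {η : ℝ} (hη : 0 < η) :
    ∀ᶠ i in l, ((A i).card * (B i).card : ℝ) *
      Real.exp (-η * (Real.log (Q i) / Real.log (Real.log (Q i)))) ≤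
        (quotientSet (A i) (B i)).card := by
  have hlog2 : 1 / 2 < Real.log 2 := by linarith [Real.log_two_gt_d9]
  obtain ⟨t, ht⟩ : ∃ t : ℕ, ((2 : ℝ) ^ t)⁻¹ < η / 8 := by
    simpa [one_div, inv_pow] using
      exists_pow_lt_of_lt_one (show 0 < η / 8 by positivity) (show (1 / 2 : ℝ) < 1 by norm_num)
  set κ := min 6 (η / (4 * (t + 3))) with hκdef
  have hκ0 : 0 < κ := by positivity
  have hκ1 : κ / 12 ≤ Real.log 2 := by linarith [min_le_left 6 (η / (4 * ((t : ℝ) + 3)))]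
  have hκ2 : 2 * (t + 3) * κ ≤ η / 2 := by
    calc 2 * (t + 3) * κ ≤ 2 * (t + 3) * (η / (4 * (t + 3))) := by
          gcongr; exact min_le_right _ _
      _ = η / 2 := by field_simp; norm_num
  have hL := tendsto_log_div_log_log.comp hQ
  filter_upwards [hE (κ / 12) (by positivity),
    hQ.eventually (eventually_card_divisors_le (show 0 < κ / 12 by positivity)),
    hL.eventually (eventually_ge_atTop (12 / κ))] with i h1 h2 h3
  simp only [Function.comp_apply] at h3
  set L := Real.log (Q i) / Real.log (Real.log (Q i)) with hLdef
  have hL0 : 0 ≤ L := le_trans (by positivity) h3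
  have hL1 : 1 ≤ κ / 12 * L := by
    calc 1 = κ / 12 * (12 / κ) := by field_simp
      _ ≤ _ := by gcongr
  have hA' : ∀ a ∈ A i, a ≠ 0 := fun a ha => (Nat.one_le_iff_ne_zero.1 (hA i a ha).1)
  have hB' : ∀ b ∈ B i, b ≠ 0 := fun b hb => (Nat.one_le_iff_ne_zero.1 (hB i b hb).1)
  refine le_trans ?_ (le_card_quotientSet hA' hB' t hκ1 hL0
    (by linarith [Real.add_one_le_exp (κ / 12 * L)])
    (fun a ha => h2 a (hA' a ha) (hA i a ha).2) (fun b hb => h2 b (hB' b hb) (hB i b hb).2) h1)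
  gcongr
  linarith

theorem eqMulExp_zero_of_eventually_le {ι : Type*} {l : Filter ι} {Q X Y : ι → ℝ}
    (hQ : Tendsto Q l atTop) (hY : ∀ i, 0 ≤ Y i) (hX : ∀ i, 0 ≤ X i) (hXY : ∀ i, X i ≤ Y i)
    (h : ∀ η > 0, ∀ᶠ i in l,
      Y i * Real.exp (-η * (Real.log (Q i) / Real.log (Real.log (Q i)))) ≤ X i) :
    EqMulExp l Q X Y 0 := by
  have hL := (tendsto_log_div_log_log.comp hQ).eventually (eventually_gt_atTop 0)
  simp only [Function.comp_apply] at hL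
  have key : ∀ η > 0, ∀ᶠ i in l, 0 < Y i → 0 < X i ∧
      -η ≤ Real.log (X i / Y i) / (Real.log (Q i) / Real.log (Real.log (Q i))) := by
    intro η hη
    filter_upwards [h η hη, hL] with i hi hLi hYi
    have hXi : 0 < X i := lt_of_lt_of_le (mul_pos hYi (Real.exp_pos _)) hi
    refine ⟨hXi, ?_⟩
    rw [le_div_iff₀ hLi, Real.le_log_iff_exp_le (by positivity), le_div_iff₀ hYi, mul_comm]
    exact hi
  refine ⟨fun i => Real.log (X i / Y i) / (Real.log (Q i) / Real.log (Real.log (Q i))), ?_, ?_⟩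
  · rw [Metric.tendsto_nhds]
    intro η hη
    filter_upwards [key (η / 2) (by positivity), hL] with i hi hLi
    rw [Real.dist_eq, sub_zero, abs_lt]
    rcases (hY i).eq_or_lt with h0 | hpos
    · rw [← h0]
      simp [hη]
    · have hle : Real.log (X i / Y i) ≤ 0 :=
        Real.log_nonpos (div_nonneg (hX i) (hY i)) ((div_le_one hpos).2 (hXY i))
      have h1 := div_nonpos_of_nonpos_of_nonneg hle hLi.le
      have h2 := (hi hpos).2
      constructor <;> linarith
  · filter_upwards [key 1 one_pos, hL] with i hi hLi
    rcases (hY i).eq_or_lt with h0 | hpos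
    · have : X i = 0 := le_antisymm (h0 ▸ hXY i) (hX i)
      rw [this, ← h0, zero_mul]
    · rw [zero_add, div_mul_cancel₀ _ hLi.ne', Real.exp_log (div_pos (hi hpos).1 hpos),
        mul_div_cancel₀ _ hpos.ne']

theorem mainTheorem2 {ι : Type*} (l : Filter ι) (Q : ι → ℝ) (hQ : Tendsto Q l atTop)
    (A B : ι → Finset ℕ)
    (hA : ∀ i, ∀ a ∈ A i, 1 ≤ a ∧ (a : ℝ) ≤ Q i)
    (hB : ∀ i, ∀ b ∈ B i, 1 ≤ b ∧ (b : ℝ) ≤ Q i) :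
    (EqMulExp l Q (fun i => (Finset.mulEnergy (A i) (B i) : ℝ))
        (fun i => ((A i).card : ℝ) * ((B i).card : ℝ)) (2 * Real.log 2) →
      EqMulExp l Q (fun i => ((quotientSet (A i) (B i)).card : ℝ))
        (fun i => ((A i).card : ℝ) * ((B i).card : ℝ)) 0) ∧
    (EqMulExp l Q (fun i => ((A i * B i).card : ℝ))
        (fun i => ((A i).card : ℝ) * ((B i).card : ℝ)) (-2 * Real.log 2) →
      EqMulExp l Q (fun i => ((quotientSet (A i) (B i)).card : ℝ))
        (fun i => ((A i).card : ℝ) * ((B i).card : ℝ)) 0) := by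
  have hL := (tendsto_log_div_log_log.comp hQ).eventually (eventually_gt_atTop 0)
  simp only [Function.comp_apply] at hL
  have main : (∀ η > 0, ∀ᶠ i in l, ((A i).card * (B i).card : ℝ) *
      Real.exp ((2 * Real.log 2 - η) * (Real.log (Q i) / Real.log (Real.log (Q i)))) ≤
        Finset.mulEnergy (A i) (B i)) →
      EqMulExp l Q (fun i => ((quotientSet (A i) (B i)).card : ℝ))
        (fun i => ((A i).card : ℝ) * ((B i).card : ℝ)) 0 := fun hE =>
    eqMulExp_zero_of_eventually_le hQ (fun i => by positivity) (fun i => by positivity)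
      (fun i => by exact_mod_cast card_quotientSet_le (A i) (B i))
      fun η hη => eventually_le_card_quotientSet hQ hA hB hE hη
  refine ⟨fun ⟨e, he, h⟩ => main fun η hη => ?_, fun ⟨e, he, h⟩ => main fun η hη => ?_⟩
  · filter_upwards [h, hL, he.eventually (lt_mem_nhds (show -η < 0 by linarith))]
      with i hi hLi hei
    rw [hi]
    gcongr
    linarith
  · filter_upwards [h, hL, he.eventually (gt_mem_nhds hη)] with i hi hLi hei
    set L := Real.log (Q i) / Real.log (Real.log (Q i))
    set N : ℝ := ((A i).card : ℝ) * ((B i).card : ℝ) with hN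
    have hN0 : 0 ≤ N := by positivity
    rcases hN0.eq_or_lt with h0 | hpos
    · rw [← h0, zero_mul]
      exact Nat.cast_nonneg _
    have hcs : N ^ 2 ≤ (A i * B i).card * (Finset.mulEnergy (A i) (B i) : ℝ) := by
      rw [hN, mul_pow]
      exact_mod_cast Finset.le_card_mul_mul_mulEnergy (A i) (B i)
    rw [hi] at hcs
    have h1 : N ≤ Real.exp ((-2 * Real.log 2 + e i) * L) * Finset.mulEnergy (A i) (B i) := by
      refine le_of_mul_le_mul_left ?_ hpos
      rw [← sq, ← mul_assoc]
      exact hcs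
    have h2 : N * Real.exp (-((-2 * Real.log 2 + e i) * L)) ≤
        Finset.mulEnergy (A i) (B i) := by
      rw [Real.exp_neg, ← div_eq_mul_inv, div_le_iff₀' (Real.exp_pos _)]
      exact h1
    refine le_trans ?_ h2
    gcongr
    nlinarith
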